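/- For integers $n\ge 0$ and $k\ge 1$ let $\sigma_{n,k}$ be the elementary symmetric polynomial of degree $k$ in $n$ variables over $\mathbb{F}_2$ (so $\sigma_{n,k}=0$ if $n<k$). For a polynomial $F$ in $n$ variables over $\mathbb{F}_2$ let $S(F)=\sum_{x\in\mathbb{F}_2^n}(-1)^{F(x)}$, and call $F$ balanced if $S(F)=0$. Let $k$ be an integer with $1<k<2048$ that is not a power of $2$, and let $r$ be the integer with $2^{r-1}<k<2^r$. Then there is a prime $p$ of the form $p=2^r m+1$, with $m$ a positive integer, such that $p\nmid S(\sigma_{n,k})$ for every $n\ge 0$. In particular, $\sigma_{n,k}$ is not balanced for any $n$. Moreover, for $k=1292$ (where $r=11$), the smallest prime $p$ of this form such that $p\nmid S(\sigma_{n,1292})$ for every $n\ge 0$ is $p=176129$. -/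

import Mathlib

namespace BoolSym

/-- The exponential sum `S(F) = ∑_{x ∈ 𝔽₂ⁿ} (-1)^{F(x)}` of a polynomial `F` in `n` variables
over `𝔽₂`. -/
noncomputable def expSum {n : ℕ} (F : MvPolynomial (Fin n) (ZMod 2)) : ℤ :=
  ∑ x : Fin n → ZMod 2, (-1 : ℤ) ^ (MvPolynomial.eval x F).val

/-- A Boolean function `F` is balanced if `S(F) = 0`. -/
def IsBalanced {n : ℕ} (F : MvPolynomial (Fin n) (ZMod 2)) : Prop :=
  expSum F = 0

/-- The elementary symmetric polynomial `σ_{n,k}` of degree `k` in `n` variables over `𝔽₂`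
(it is `0` if `n < k`). -/
noncomputable def sigma (n k : ℕ) : MvPolynomial (Fin n) (ZMod 2) :=
  MvPolynomial.esymm (Fin n) (ZMod 2) k

/-- An integer sequence avoids `p` if `p` divides none of its terms. -/
def Avoids (x : ℕ → ℤ) (p : ℕ) : Prop :=
  ∀ n, ¬ (p : ℤ) ∣ x n

/-- The primes `p = 2 ^ r * m + 1` with `m` a positive integer and `2 ^ (r - 1) < k < 2 ^ r`
that the sequence `n ↦ S(σ_{n,k})` avoids. -/
def avoidedPrimes (k : ℕ) : Set ℕ :=
  {p | p.Prime ∧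
    (∃ r m : ℕ, 2 ^ (r - 1) < k ∧ k < 2 ^ r ∧ 0 < m ∧ p = 2 ^ r * m + 1) ∧
    Avoids (fun n => expSum (sigma n k)) p}

end BoolSym

/-!
# Elementary symmetric Boolean functions avoid primes

By Lucas' theorem `S(σ_{n,k}) = 2 ^ n - 2 * T n`, where `T n` (`oddSum k n`) is the sum of the
`n.choose j` over the `j` whose binary digits dominate those of `k` (`expSum_sigma`).

*Generating function.* From `∑ n, (n.choose j) X ^ n = X ^ j / (1 - X) ^ (j + 1)`, removing the
binary digits of `k` one at a time (`oddSeries_two_pow_add`) gives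
`∑ n, T n X ^ n = X ^ k / ((1 - 2 X) Π)`, where `Π` is the product of `(1 - X) ^ 2 ^ i + X ^ 2 ^ i`
over the binary digits `i` of `k`. Hence the half sums `S(σ_{n+1,k}) / 2` have the generating
function `(Π - X ^ (k - 1)) / ((1 - 2 X) Π)` (`denPoly_mul_halfSeries`).

*Periodicity.* Let `k < 2 ^ r` and let `p = 2 ^ r m + 1` be prime. Whether `j` dominates `k` depends
only on `j` modulo `2 ^ r`, so `X ^ p` acts like `X`, and the Frobenius identity
`(1 + X) ^ p = 1 + X ^ p` shows that the half sums modulo `p` have period `p - 1`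
(`oddSum_add_prime`, `halfSum_mod`). It remains to see that `p - 1` terms of a power series quotient
over `𝔽_p` are nonzero.

*Computation.* These terms are computed by long division in `m` blocks of `2 ^ r` terms. Polynomials
over `𝔽_p` are packed into natural numbers (Kronecker substitution `X = 2 ^ w`), so that one block
costs two multiplications of large numbers. Only the results are verified: if
`D * B + 2 ^ (w * 2 ^ r) * C' = C + p * Q` holds for natural numbers all of whose base-`2 ^ w` digits
are small, then no carries occur and the equality is one of polynomials modulo `p`
(`mulCheck_spec`); this makes `B` the next block of the quotient and `C'` the next remainder
(`blockCheck_spec`). How `B` and `C'` were found (Barrett reduction, Newton inversion) is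
irrelevant to the proof.

The primes assigned to the various `k` are listed in `certificates`. For `k = 1292` each smaller
prime `2048 m + 1` is excluded by an explicit vanishing term (`vanishingIndices`).
-/

namespace BoolSym

open Finset

/-! ### Exponential sums as sums of binomial coefficients -/

/-- The sum of the binomial coefficients `n.choose j` over those `j` whose binary digits dominate
the binary digits of `k`; by Lucas' theorem these are the `j` with `j.choose k` odd. -/
def oddSum (k n : ℕ) : ℕ :=
  ∑ j ∈ range (n + 1), if Odd (j.choose k) then n.choose j else 0

theorem eval_sigma {n : ℕ} (k : ℕ) (x : Fin n → ZMod 2) :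
    MvPolynomial.eval x (sigma n k) = ((#{i | x i = 1}).choose k : ZMod 2) := by
  have hx : ∀ i, x i = if x i = 1 then 1 else 0 := by
    intro i; generalize x i = a; revert a; decide
  rw [sigma, MvPolynomial.esymm, map_sum, ← card_powersetCard, card_eq_sum_ones, Nat.cast_sum]
  simp only [map_prod, MvPolynomial.eval_X, Nat.cast_one]
  rw [← sum_subset (powersetCard_mono (subset_univ (univ.filter fun i => x i = 1)))]
  · refine sum_congr rfl fun s hs => prod_eq_one fun i hi => ?_
    exact (mem_filter.1 ((mem_powersetCard.1 hs).1 hi)).2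
  · intro s hs hs'
    rw [mem_powersetCard] at hs hs'
    have : ¬ s ⊆ univ.filter fun i => x i = 1 := fun h => hs' ⟨h, hs.2⟩
    obtain ⟨i, hi, hi'⟩ := not_subset.1 this
    refine prod_eq_zero hi ?_
    rw [hx i, if_neg fun h => hi' (mem_filter.2 ⟨mem_univ _, h⟩)]

theorem neg_one_pow_val_natCast (a : ℕ) :
    (-1 : ℤ) ^ ((a : ZMod 2)).val = 1 - 2 * if Odd a then 1 else 0 := by
  rw [ZMod.val_natCast]
  by_cases h : Odd a
  · simp [h, Nat.odd_iff.1 h]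
  · simp [h, Nat.even_iff.1 (Nat.not_odd_iff_even.1 h)]

theorem expSum_sigma (n k : ℕ) : expSum (sigma n k) = 2 ^ n - 2 * oddSum k n := by
  have key : expSum (sigma n k) =
      ∑ s ∈ (univ : Finset (Fin n)).powerset, (-1 : ℤ) ^ ((#s).choose k : ZMod 2).val := by
    unfold expSum
    refine sum_bij' (fun x _ => univ.filter fun i => x i = 1)
      (fun s _ i => if i ∈ s then 1 else 0) (by simp) (by simp) ?_ (by simp) ?_
    · intro x _
      funext i
      simp only [mem_filter, mem_univ, true_and]
      generalize x i = a
      revert a; decide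
    · intro x _
      rw [eval_sigma]
  rw [key, sum_powerset_apply_card (fun j => (-1 : ℤ) ^ (j.choose k : ZMod 2).val), card_univ,
    Fintype.card_fin]
  have h2 : (2 : ℤ) ^ n = ∑ j ∈ range (n + 1), (n.choose j : ℤ) := by
    have := Nat.sum_range_choose n
    exact_mod_cast this.symm
  rw [h2, oddSum, Nat.cast_sum, mul_sum, ← sum_sub_distrib]
  refine sum_congr rfl fun j _ => ?_
  rw [neg_one_pow_val_natCast]
  split_ifs
  · simp; ring
  · simp

/-- Lucas' theorem modulo two. -/
theorem odd_choose_iff (j k : ℕ) :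
    Odd (j.choose k) ↔ ∀ i, k.testBit i = true → j.testBit i = true := by
  induction k using Nat.strong_induction_on generalizing j with
  | _ k ih =>
    rcases Nat.eq_zero_or_pos k with rfl | hk
    · simp
    have h := Choose.choose_modEq_choose_mod_mul_choose_div_nat (n := j) (k := k) (p := 2)
    have h1 : Odd (j.choose k) ↔
        Odd ((j % 2).choose (k % 2)) ∧ Odd ((j / 2).choose (k / 2)) := by
      rw [← Nat.odd_mul, Nat.odd_iff, Nat.odd_iff]
      exact ⟨fun e => h ▸ e, fun e => h.symm ▸ e⟩
    rw [h1, ih (k / 2) (Nat.div_lt_self hk one_lt_two)]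
    have h0 : Odd ((j % 2).choose (k % 2)) ↔ (k.testBit 0 = true → j.testBit 0 = true) := by
      rcases Nat.mod_two_eq_zero_or_one j with hj | hj <;>
      rcases Nat.mod_two_eq_zero_or_one k with hk | hk <;> simp [hj, hk]
    rw [h0]
    constructor
    · rintro ⟨h0, hs⟩ (_ | i) hi
      · exact h0 hi
      · rw [Nat.testBit_succ] at hi ⊢
        exact hs i hi
    · intro H
      exact ⟨H 0, fun i hi => by
        rw [← Nat.testBit_succ] at hi ⊢
        exact H _ hi⟩

theorem oddSum_zero_right {k : ℕ} (hk : 1 ≤ k) : oddSum k 0 = 0 := by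
  simp [oddSum, Nat.choose_eq_zero_of_lt hk]

theorem oddSum_zero_left (n : ℕ) : oddSum 0 n = 2 ^ n := by
  simp [oddSum, Nat.sum_range_choose]

/-- For `k < 2 ^ r` the parity of `j.choose k` depends only on `j` modulo `2 ^ r`. -/
theorem odd_choose_congr {r k i j : ℕ} (hk : k < 2 ^ r) (h : i % 2 ^ r = j % 2 ^ r) :
    Odd (i.choose k) ↔ Odd (j.choose k) := by
  rw [odd_choose_iff, odd_choose_iff]
  refine forall_congr' fun s => ?_
  by_cases hs : s < r
  · have := congrArg (fun t => t.testBit s) h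
    simp only [Nat.testBit_mod_two_pow, hs, decide_true, Bool.true_and] at this
    rw [this]
  · have : k.testBit s = false :=
      Nat.testBit_lt_two_pow (hk.trans_le (Nat.pow_le_pow_right two_pos (not_lt.1 hs)))
    simp [this]

/-! ### Periodicity modulo a prime -/

section Period
open Polynomial

variable {p : ℕ}

/-- The linear functional on polynomials sending `X ^ j` to `1` or `0` according to the parity
of `j.choose k`. -/
noncomputable def oddFunctional (p k : ℕ) : (ZMod p)[X] →ₗ[ZMod p] ZMod p :=
  Polynomial.lsum fun j => if Odd (j.choose k) then LinearMap.id else 0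

theorem oddFunctional_X_pow (k j : ℕ) :
    oddFunctional p k (X ^ j) = if Odd (j.choose k) then 1 else 0 := by
  rw [← monomial_one_right_eq_X_pow, oddFunctional, lsum_apply, sum_monomial_index]
  · split_ifs <;> simp
  · simp

theorem oddFunctional_one_add_X_pow (k n : ℕ) :
    oddFunctional p k ((1 + X) ^ n) = (oddSum k n : ZMod p) := by
  rw [add_comm, add_pow, map_sum, oddSum, Nat.cast_sum]
  refine sum_congr rfl fun j _ => ?_
  rw [one_pow, mul_one, mul_comm, ← nsmul_eq_mul, map_nsmul, oddFunctional_X_pow]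
  split_ifs <;> simp

theorem oddFunctional_X_pow_mul [Fact p.Prime] {r k : ℕ} (hk : k < 2 ^ r) (hp : 2 ^ r ∣ p - 1)
    (g : (ZMod p)[X]) : oddFunctional p k (X ^ p * g) = oddFunctional p k (X * g) := by
  induction g using Polynomial.induction_on' with
  | add f g hf hg => simp only [mul_add, map_add, hf, hg]
  | monomial j a =>
    have hp1 : 1 ≤ p := (Fact.out : p.Prime).one_le
    obtain ⟨m, hm⟩ := hp
    have : Odd ((p + j).choose k) ↔ Odd ((1 + j).choose k) := by
      apply odd_choose_congr hk
      have : p + j = 1 + j + 2 ^ r * m := by omega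
      rw [this, Nat.add_mul_mod_self_left]
    rw [← C_mul_X_pow_eq_monomial, mul_left_comm, mul_left_comm X, ← pow_add, ← pow_succ',
      ← smul_eq_C_mul, ← smul_eq_C_mul, map_smul, map_smul, oddFunctional_X_pow,
      oddFunctional_X_pow, add_comm j 1]
    simp only [this]

/-- Frobenius gives `(1 + X) ^ (n + p) = (1 + X) ^ n * (1 + X ^ p)`, and `X ^ p` acts as `X`. -/
theorem oddSum_add_prime [Fact p.Prime] {r k : ℕ} (hk : k < 2 ^ r) (hp : 2 ^ r ∣ p - 1) (n : ℕ) :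
    (oddSum k (n + p) : ZMod p) = oddSum k (n + 1) := by
  rw [← oddFunctional_one_add_X_pow, ← oddFunctional_one_add_X_pow, pow_add,
    add_pow_char 1 X p, one_pow, mul_comm, add_mul, map_add, oddFunctional_X_pow_mul hk hp, one_mul,
    ← map_add, ← one_add_mul, mul_comm, ← pow_succ]

/-- Half of the exponential sum in `n + 1` variables, modulo `p`. -/
def halfSum (p k n : ℕ) : ZMod p := 2 ^ n - oddSum k (n + 1)

theorem halfSum_mod [Fact p.Prime] (h2 : p ≠ 2) {r k : ℕ} (hk : k < 2 ^ r) (hp : 2 ^ r ∣ p - 1)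
    (n : ℕ) : halfSum p k n = halfSum p k (n % (p - 1)) := by
  have hprime : p.Prime := Fact.out
  have hper : Function.Periodic (halfSum p k) (p - 1) := by
    intro n
    have h1 : (2 : ZMod p) ^ (p - 1) = 1 := ZMod.pow_card_sub_one_eq_one (by
      intro h
      have h' : ((2 : ℕ) : ZMod p) = 0 := by exact_mod_cast h
      rw [ZMod.natCast_eq_zero_iff, Nat.prime_dvd_prime_iff_eq hprime Nat.prime_two] at h'
      exact h2 h')
    have h3 : n + (p - 1) + 1 = n + p := by have := hprime.one_le; omega
    rw [halfSum, halfSum, h3, oddSum_add_prime hk hp, pow_add, h1, mul_one]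
  exact (hper.map_mod_nat n).symm

theorem expSum_eq_halfSum (p k n : ℕ) :
    ((expSum (sigma (n + 1) k) : ℤ) : ZMod p) = 2 * halfSum p k n := by
  rw [expSum_sigma, halfSum]; push_cast; ring

theorem expSum_zero {k : ℕ} (hk : 1 ≤ k) : expSum (sigma 0 k) = 1 := by
  simp [expSum_sigma, oddSum_zero_right hk]

theorem avoids_of_halfSum_ne_zero [Fact p.Prime] (h2 : p ≠ 2) {r k : ℕ} (hk1 : 1 ≤ k)
    (hk : k < 2 ^ r) (hp : 2 ^ r ∣ p - 1) (h : ∀ n < p - 1, halfSum p k n ≠ 0) :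
    Avoids (fun n => expSum (sigma n k)) p := by
  have hprime : p.Prime := Fact.out
  intro n hn
  rcases n with _ | n
  · simp only [expSum_zero hk1] at hn
    have := Int.eq_one_of_dvd_one (Int.natCast_nonneg p) hn
    exact hprime.one_lt.ne' (by exact_mod_cast this)
  · have h0 : ((expSum (sigma (n + 1) k) : ℤ) : ZMod p) = 0 :=
      (ZMod.intCast_zmod_eq_zero_iff_dvd _ _).2 hn
    rw [expSum_eq_halfSum, halfSum_mod h2 hk hp] at h0
    rcases mul_eq_zero.1 h0 with h0 | h0
    · have h' : ((2 : ℕ) : ZMod p) = 0 := by exact_mod_cast h0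
      rw [ZMod.natCast_eq_zero_iff, Nat.prime_dvd_prime_iff_eq hprime Nat.prime_two] at h'
      exact h2 h'
    · exact h _ (Nat.mod_lt _ (by have := hprime.two_le; omega)) h0

theorem dvd_expSum_of_halfSum_eq_zero {p k n : ℕ} (h : halfSum p k n = 0) :
    (p : ℤ) ∣ expSum (sigma (n + 1) k) := by
  rw [← ZMod.intCast_zmod_eq_zero_iff_dvd, expSum_eq_halfSum, h, mul_zero]

end Period

/-! ### The generating function -/

section GeneratingFunction
open PowerSeries

theorem odd_choose_two_pow_add {i a : ℕ} (ha : a < 2 ^ i) (j : ℕ) :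
    Odd (j.choose (2 ^ i + a)) ↔ j.testBit i = true ∧ Odd (j.choose a) := by
  rw [odd_choose_iff, odd_choose_iff]
  have hai : a.testBit i = false := Nat.testBit_lt_two_pow ha
  have hbit : ∀ s, (2 ^ i + a).testBit s = true ↔ s = i ∨ a.testBit s = true := by
    intro s
    have h := Nat.two_pow_add_eq_or_of_lt ha 1
    rw [mul_one] at h
    rw [h, Nat.testBit_or, Nat.testBit_two_pow, Bool.or_eq_true, decide_eq_true_iff, eq_comm]
  constructor
  · exact fun H => ⟨H i ((hbit i).2 (Or.inl rfl)), fun s hs => H s ((hbit s).2 (Or.inr hs))⟩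
  · rintro ⟨h1, h2⟩ s hs
    rcases (hbit s).1 hs with rfl | hs
    exacts [h1, h2 s hs]

variable (R : Type*) [CommRing R]

/-- The power series `∑ n, (n.choose j) X ^ n`, that is, `X ^ j / (1 - X) ^ (j + 1)`. -/
noncomputable def chooseSeries (j : ℕ) : R⟦X⟧ := mk fun n => (n.choose j : R)

/-- The generating function of `n ↦ oddSum k n`. -/
noncomputable def oddSeries (k : ℕ) : R⟦X⟧ := mk fun n => (oddSum k n : R)

/-- The first `M` terms of the expansion of `oddSeries R k` in the series `chooseSeries R j`. -/
noncomputable def oddSeriesTrunc (k M : ℕ) : R⟦X⟧ :=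
  ∑ j ∈ range M, if Odd (j.choose k) then chooseSeries R j else 0

variable {R}

theorem one_sub_X_mul_chooseSeries (j : ℕ) :
    (1 - X) * chooseSeries R (j + 1) = X * chooseSeries R j := by
  ext n
  rw [sub_mul, one_mul, map_sub]
  rcases n with _ | n
  · simp [chooseSeries]
  · simp [chooseSeries, coeff_succ_X_mul, Nat.choose_succ_succ]

theorem one_sub_X_pow_mul_chooseSeries (h j : ℕ) :
    (1 - X) ^ h * chooseSeries R (j + h) = X ^ h * chooseSeries R j := by
  induction h generalizing j with
  | zero => simp
  | succ h ih =>
    rw [pow_succ, mul_assoc, ← add_assoc, one_sub_X_mul_chooseSeries, mul_left_comm, ih, pow_succ']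
    ring

theorem X_pow_dvd_oddSeries_sub {k m M : ℕ} (h : m ≤ M) :
    (X : R⟦X⟧) ^ m ∣ oddSeries R k - oddSeriesTrunc R k M := by
  rw [X_pow_dvd_iff]
  intro n hn
  rw [map_sub, sub_eq_zero, oddSeries, oddSeriesTrunc, coeff_mk, map_sum, oddSum, Nat.cast_sum]
  rw [← sum_subset (range_subset_range.2 (show n + 1 ≤ M by omega))]
  · refine sum_congr rfl fun j _ => ?_
    split_ifs <;> simp [chooseSeries]
  · intro j _ hj
    have : n.choose j = 0 := Nat.choose_eq_zero_of_lt (by simpa using hj)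
    split_ifs <;> simp [chooseSeries, this]

/-- Exactly one of `j`, `j + 2 ^ i` has its `i`-th binary digit equal to one. -/
theorem oddSeriesTrunc_two_pow_add {i a : ℕ} (ha : a < 2 ^ i) (M : ℕ) :
    (1 - X) ^ 2 ^ i * oddSeriesTrunc R (2 ^ i + a) (M + 2 ^ i) +
      X ^ 2 ^ i * oddSeriesTrunc R (2 ^ i + a) M = X ^ 2 ^ i * oddSeriesTrunc R a M := by
  have h1 : (1 - X) ^ 2 ^ i * oddSeriesTrunc R (2 ^ i + a) (M + 2 ^ i) =
      X ^ 2 ^ i * ∑ j ∈ range M,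
        if Odd ((j + 2 ^ i).choose (2 ^ i + a)) then chooseSeries R j else 0 := by
    rw [oddSeriesTrunc, add_comm M, sum_range_add, sum_eq_zero, zero_add, mul_sum, mul_sum]
    · refine sum_congr rfl fun j _ => ?_
      rw [add_comm (2 ^ i) j]
      split_ifs
      · exact one_sub_X_pow_mul_chooseSeries _ _
      · simp
    · intro j hj
      rw [if_neg]
      rw [Nat.choose_eq_zero_of_lt (by have := mem_range.1 hj; omega)]
      simp
  rw [h1, ← mul_add, oddSeriesTrunc, oddSeriesTrunc, ← sum_add_distrib]
  congr 1
  refine sum_congr rfl fun j _ => ?_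
  have h2 : Odd ((j + 2 ^ i).choose a) ↔ Odd (j.choose a) :=
    odd_choose_congr ha (by simp)
  have h3 : (j + 2 ^ i).testBit i = !j.testBit i := by rw [add_comm, Nat.testBit_two_pow_add_eq]
  simp only [odd_choose_two_pow_add ha, h2, h3]
  cases j.testBit i <;> simp

theorem oddSeries_two_pow_add {i a : ℕ} (ha : a < 2 ^ i) :
    ((1 - X) ^ 2 ^ i + X ^ 2 ^ i) * oddSeries R (2 ^ i + a) = X ^ 2 ^ i * oddSeries R a := by
  rw [← sub_eq_zero]
  ext n
  rw [map_zero]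
  refine X_pow_dvd_iff.1 (?_ : X ^ (n + 1) ∣ _) n n.lt_add_one
  have h := oddSeriesTrunc_two_pow_add (R := R) ha (n + 1)
  obtain ⟨u, hu⟩ := X_pow_dvd_oddSeries_sub (R := R) (k := 2 ^ i + a)
    (show n + 1 ≤ n + 1 + 2 ^ i by omega)
  obtain ⟨v, hv⟩ := X_pow_dvd_oddSeries_sub (R := R) (k := 2 ^ i + a) (le_refl (n + 1))
  obtain ⟨t, ht⟩ := X_pow_dvd_oddSeries_sub (R := R) (k := a) (le_refl (n + 1))
  refine ⟨(1 - X) ^ 2 ^ i * u + X ^ 2 ^ i * v - X ^ 2 ^ i * t, ?_⟩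
  linear_combination (1 - X) ^ 2 ^ i * hu + X ^ 2 ^ i * hv - X ^ 2 ^ i * ht + h

theorem one_sub_two_X_mul_oddSeries_zero : (1 - 2 * X) * oddSeries R 0 = 1 := by
  have h2 : (2 : R⟦X⟧) = C (2 : R) := (map_ofNat C 2).symm
  ext n
  rw [sub_mul, one_mul, map_sub, mul_assoc, h2, coeff_C_mul]
  rcases n with _ | n
  · simp [oddSeries, oddSum_zero_left]
  · simp [oddSeries, oddSum_zero_left, coeff_succ_X_mul, pow_succ', coeff_one]

end GeneratingFunction

section Denominator
open Polynomial

/-- The product of `(1 - X) ^ 2 ^ i + X ^ 2 ^ i` over the binary digits `i < s` of `k` that are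
equal to one. -/
noncomputable def bitProd (p k s : ℕ) : (ZMod p)[X] :=
  ∏ i ∈ range s, if k.testBit i then (1 - X) ^ 2 ^ i + X ^ 2 ^ i else 1

theorem bitProd_mul_oddSeries (p k s : ℕ) :
    (bitProd p k s : PowerSeries (ZMod p)) * oddSeries (ZMod p) (k % 2 ^ s) =
      PowerSeries.X ^ (k % 2 ^ s) * oddSeries (ZMod p) 0 := by
  induction s with
  | zero => simp [bitProd, Nat.mod_one]
  | succ s ih =>
    have hlt : k % 2 ^ s < 2 ^ s := Nat.mod_lt _ (by positivity)
    rw [bitProd, prod_range_succ, ← bitProd]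
    rcases hb : k.testBit s with _ | _
    · have hmod : k % 2 ^ (s + 1) = k % 2 ^ s := by
        rw [Nat.mod_pow_succ]
        rw [Nat.testBit_eq_decide_div_mod_eq, decide_eq_false_iff_not] at hb
        have : k / 2 ^ s % 2 = 0 := by omega
        simp [this]
      rw [hmod]
      simpa using ih
    · have hmod : k % 2 ^ (s + 1) = 2 ^ s + k % 2 ^ s := by
        rw [Nat.mod_pow_succ]
        rw [Nat.testBit_eq_decide_div_mod_eq, decide_eq_true_iff] at hb
        rw [hb]; ring
      rw [hmod, if_pos rfl]
      have h := oddSeries_two_pow_add (R := ZMod p) hlt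
      push_cast
      rw [mul_assoc, h, mul_left_comm, ih, pow_add]
      ring

/-- The common denominator of the generating functions. -/
noncomputable def denPoly (p k s : ℕ) : (ZMod p)[X] := (1 - 2 * X) * bitProd p k s

/-- The generating function of `halfSum p k`. -/
noncomputable def halfSeries (p k : ℕ) : PowerSeries (ZMod p) := PowerSeries.mk (halfSum p k)

theorem denPoly_mul_halfSeries {p k s : ℕ} (hk1 : 1 ≤ k) (hk : k < 2 ^ s) :
    (denPoly p k s : PowerSeries (ZMod p)) * halfSeries p k =
      ((bitProd p k s - X ^ (k - 1) : (ZMod p)[X]) : PowerSeries (ZMod p)) := by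
  have hB := bitProd_mul_oddSeries p k s
  rw [Nat.mod_eq_of_lt hk] at hB
  have h0 := one_sub_two_X_mul_oddSeries_zero (R := ZMod p)
  have hX : PowerSeries.X * halfSeries p k =
      PowerSeries.X * oddSeries (ZMod p) 0 - oddSeries (ZMod p) k := by
    ext n
    rcases n with _ | n
    · simp [oddSeries, oddSum_zero_right hk1]
    · simp [PowerSeries.coeff_succ_X_mul, halfSeries, halfSum, oddSeries, oddSum_zero_left]
  apply PowerSeries.X_mul_inj.1
  have hXk : (PowerSeries.X : PowerSeries (ZMod p)) ^ k =
      PowerSeries.X * PowerSeries.X ^ (k - 1) := by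
    rw [← pow_succ', Nat.sub_add_cancel hk1]
  have h2 : ((2 : (ZMod p)[X]) : PowerSeries (ZMod p)) = 2 := by
    exact map_ofNat Polynomial.coeToPowerSeries.ringHom 2
  rw [denPoly]
  push_cast
  rw [h2]
  linear_combination (1 - 2 * PowerSeries.X) * (bitProd p k s : PowerSeries (ZMod p)) * hX
    - (1 - 2 * PowerSeries.X) * hB + (PowerSeries.X * bitProd p k s - PowerSeries.X ^ k) * h0 - hXk

end Denominator

/-! ### Packed polynomials -/

section Lanes
open Polynomial

/-- The polynomial whose coefficients are the base-`2 ^ w` digits ("lanes") of `V`. -/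
noncomputable def lanes (w V : ℕ) : ℕ[X] :=
  ∑ i ∈ range V, monomial i (V / (2 ^ w) ^ i % 2 ^ w)

theorem coeff_lanes {w : ℕ} (hw : 0 < w) (V i : ℕ) :
    (lanes w V).coeff i = V / (2 ^ w) ^ i % 2 ^ w := by
  rw [lanes, finsetSum_coeff]
  simp only [coeff_monomial]
  rw [sum_ite_eq' (range V) i]
  split_ifs with h
  · rfl
  · have h1 : V < (2 ^ w) ^ i :=
      (not_lt.1 (fun h' => h (mem_range.2 h'))).trans_lt
        (Nat.lt_pow_self (Nat.one_lt_two_pow hw.ne'))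
    rw [Nat.div_eq_of_lt h1, Nat.zero_mod]

theorem coeff_lanes_lt {w : ℕ} (hw : 0 < w) (V i : ℕ) : (lanes w V).coeff i < 2 ^ w := by
  rw [coeff_lanes hw]; exact Nat.mod_lt _ (by positivity)

theorem coeff_lanes_eq_zero {w L V i : ℕ} (hw : 0 < w) (hV : V < 2 ^ (w * L)) (hi : L ≤ i) :
    (lanes w V).coeff i = 0 := by
  rw [coeff_lanes hw, Nat.div_eq_of_lt, Nat.zero_mod]
  rw [pow_mul] at hV
  exact hV.trans_le (Nat.pow_le_pow_right (by positivity) hi)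

theorem eval_lanes {w : ℕ} (hw : 0 < w) (V : ℕ) : (lanes w V).eval (2 ^ w) = V := by
  have h : ∀ n, ∑ i ∈ range n, (V / (2 ^ w) ^ i % 2 ^ w) * (2 ^ w) ^ i = V % (2 ^ w) ^ n := by
    intro n
    induction n with
    | zero => simp [Nat.mod_one]
    | succ n ih => rw [sum_range_succ, ih, Nat.mod_pow_succ, mul_comm ((2 ^ w) ^ n)]
  rw [lanes, eval_finsetSum]
  simp only [eval_monomial]
  rw [h, Nat.mod_eq_of_lt (Nat.lt_pow_self (Nat.one_lt_two_pow hw.ne'))]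

theorem coeff_eq_eval_div {x : ℕ} (P : ℕ[X]) (hP : ∀ i, P.coeff i < x) (i : ℕ) :
    P.eval x / x ^ i % x = P.coeff i := by
  have hx : 0 < x := (Nat.zero_le _).trans_lt (hP 0)
  have hdec : P.eval x = P.coeff 0 + x * P.divX.eval x := by
    conv_lhs => rw [← divX_mul_X_add P]
    simp [add_comm, mul_comm]
  induction i generalizing P with
  | zero => rw [pow_zero, Nat.div_one, hdec, Nat.add_mul_mod_self_left, Nat.mod_eq_of_lt (hP 0)]
  | succ i ih =>
    have hdiv : P.eval x / x = P.divX.eval x := by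
      rw [hdec, Nat.add_mul_div_left _ _ hx, Nat.div_eq_of_lt (hP 0), zero_add]
    rw [pow_succ', ← Nat.div_div_eq_div_mul, hdiv, ih, coeff_divX]
    · intro j; rw [coeff_divX]; exact hP _
    · conv_lhs => rw [← divX_mul_X_add P.divX]
      simp [add_comm, mul_comm]

/-- A polynomial with coefficients below `2 ^ w` is determined by its value at `2 ^ w`. -/
theorem lanes_eval {w : ℕ} (hw : 0 < w) {P : ℕ[X]} (hP : ∀ i, P.coeff i < 2 ^ w) :
    lanes w (P.eval (2 ^ w)) = P := by
  ext i
  rw [coeff_lanes hw, coeff_eq_eval_div P hP]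

theorem lanes_mul_two_pow {w : ℕ} (hw : 0 < w) (V n : ℕ) :
    lanes w (V * 2 ^ (w * n)) = lanes w V * X ^ n := by
  rw [← lanes_eval hw (P := lanes w V * X ^ n), eval_mul, eval_lanes hw, eval_pow, eval_X, pow_mul]
  intro i
  rw [coeff_mul_X_pow']
  split_ifs
  · exact coeff_lanes_lt hw _ _
  · positivity

theorem lanes_of_lt {w c : ℕ} (hw : 0 < w) (hc : c < 2 ^ w) : lanes w c = C c := by
  rw [← lanes_eval hw (P := C c), eval_C]
  intro i
  rw [coeff_C]
  split_ifs
  · exact hc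
  · positivity

/-- The polynomial over `ZMod p` packed in `V`. -/
noncomputable def unpack (p w V : ℕ) : (ZMod p)[X] := (lanes w V).map (Nat.castRingHom (ZMod p))

theorem coeff_unpack (p w V i : ℕ) : (unpack p w V).coeff i = ((lanes w V).coeff i : ZMod p) := by
  rw [unpack, coeff_map, eq_natCast]

theorem unpack_mul_two_pow {p w : ℕ} (hw : 0 < w) (V n : ℕ) :
    unpack p w (V * 2 ^ (w * n)) = unpack p w V * X ^ n := by
  simp [unpack, lanes_mul_two_pow hw]

theorem unpack_of_lt {p w c : ℕ} (hw : 0 < w) (hc : c < 2 ^ w) :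
    unpack p w c = C (c : ZMod p) := by
  simp [unpack, lanes_of_lt hw hc]

/-- The number with `L` lanes of width `w`, each equal to one. -/
def ones (w L : ℕ) : ℕ := (2 ^ (w * L) - 1) / (2 ^ w - 1)

theorem ones_eq {w : ℕ} (hw : 0 < w) (L : ℕ) : ones w L = ∑ i ∈ range L, (2 ^ w) ^ i := by
  rw [ones, pow_mul, Nat.geomSum_eq (by have := Nat.one_lt_two_pow hw.ne'; omega)]

/-- The number with `L` lanes of width `w`, each having exactly the bits `b, …, w - 1` set. -/
def highBits (w L b : ℕ) : ℕ := ones w L * (2 ^ w - 2 ^ b)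

theorem lt_of_and_highBits {w b v : ℕ} (hb : b ≤ w) (hv : v < 2 ^ w)
    (h : v &&& (2 ^ w - 2 ^ b) = 0) : v < 2 ^ b := by
  have h1 : v / 2 ^ b &&& (2 ^ w - 2 ^ b) / 2 ^ b = 0 := by
    rw [← Nat.and_div_two_pow, h, Nat.zero_div]
  have h2 : (2 ^ w - 2 ^ b) / 2 ^ b = 2 ^ (w - b) - 1 := by
    have : 2 ^ w - 2 ^ b = 2 ^ b * (2 ^ (w - b) - 1) := by
      rw [Nat.mul_sub, ← pow_add, Nat.add_sub_cancel' hb, mul_one]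
    rw [this, Nat.mul_div_cancel_left _ (by positivity)]
  have h3 : v / 2 ^ b < 2 ^ (w - b) := by
    rw [Nat.div_lt_iff_lt_mul (by positivity), ← pow_add, Nat.sub_add_cancel hb]
    exact hv
  rw [h2, Nat.and_two_pow_sub_one_eq_mod, Nat.mod_eq_of_lt h3] at h1
  rcases Nat.div_eq_zero_iff.1 h1 with h | h
  · exact absurd h (by positivity)
  · exact h

theorem lane_lt_of_and_highBits {w b : ℕ} (hw : 0 < w) (hb : b ≤ w) {L V : ℕ}
    (h : V &&& highBits w L b = 0) {i : ℕ} (hi : i < L) : V / (2 ^ w) ^ i % 2 ^ w < 2 ^ b := by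
  rw [highBits, ones_eq hw] at h
  have hlt : 2 ^ w - 2 ^ b < 2 ^ w := Nat.sub_lt (by positivity) (by positivity)
  induction L generalizing V i with
  | zero => omega
  | succ L ih =>
    rw [sum_range_succ'] at h
    simp only [pow_succ _ (_ : ℕ), ← sum_mul, pow_zero, add_mul, one_mul] at h
    set S := ∑ i ∈ range L, (2 ^ w) ^ i with hS
    set d := 2 ^ w - 2 ^ b
    have hmask : S * 2 ^ w * d + d = d + 2 ^ w * (S * d) := by ring
    rw [hmask] at h
    rcases i with _ | i
    · have h1 : (V &&& (d + 2 ^ w * (S * d))) % 2 ^ w = 0 := by rw [h, Nat.zero_mod]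
      rw [Nat.and_mod_two_pow, Nat.add_mul_mod_self_left, Nat.mod_eq_of_lt hlt] at h1
      rw [pow_zero, Nat.div_one]
      exact lt_of_and_highBits hb (Nat.mod_lt _ (by positivity)) h1
    · have h1 : (V &&& (d + 2 ^ w * (S * d))) / 2 ^ w = 0 := by rw [h, Nat.zero_div]
      rw [Nat.and_div_two_pow, Nat.add_mul_div_left _ _ (by positivity), Nat.div_eq_of_lt hlt,
        zero_add] at h1
      rw [pow_succ', ← Nat.div_div_eq_div_mul]
      exact ih h1 (by omega)

/-- Checks that `V` has at most `L` lanes of width `w`, all of them below `2 ^ b`. -/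
def lanesLt (w L b V : ℕ) : Bool :=
  and (Nat.beq (Nat.land V (highBits w L b)) 0) (Nat.beq (Nat.shiftRight V (w * L)) 0)

theorem lanesLt_spec {w L b V : ℕ} (hw : 0 < w) (hb : b ≤ w) (h : lanesLt w L b V = true) :
    V < 2 ^ (w * L) ∧ ∀ i, (lanes w V).coeff i < 2 ^ b := by
  rw [lanesLt, Bool.and_eq_true, Nat.beq_eq, Nat.beq_eq] at h
  have h1 : V < 2 ^ (w * L) := by
    have h2 : V >>> (w * L) = 0 := h.2
    rw [Nat.shiftRight_eq_div_pow] at h2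
    rcases Nat.div_eq_zero_iff.1 h2 with h | h
    · exact absurd h (by positivity)
    · exact h
  refine ⟨h1, fun i => ?_⟩
  rcases lt_or_ge i L with hi | hi
  · rw [coeff_lanes hw]
    exact lane_lt_of_and_highBits hw hb h.1 hi
  · rw [coeff_lanes_eq_zero hw h1 hi]
    positivity

end Lanes

/-! ### Certified modular arithmetic on packed polynomials

The functions evaluated by the kernel apply `Nat.add`, `Nat.mul` etc. instead of the overloaded
operations, since these are the functions for which the kernel has native arithmetic. -/

section Packed

/-- `force n f` is `f n`; the case distinction makes the kernel evaluate `n` before `f`. -/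
def force {α : Type} (n : ℕ) (f : ℕ → α) : α :=
  Nat.rec (f 0) (fun m _ => f (Nat.succ m)) n

theorem force_eq {α : Type} (n : ℕ) (f : ℕ → α) : force n f = f n := by cases n <;> rfl

/-- The lowest `L` lanes of `V`. -/
def lowLanes (w L V : ℕ) : ℕ := Nat.land V (2 ^ (w * L) - 1)

/-- The number with `L` lanes of width `w`, each having exactly the lowest `w - a` bits set. -/
def lowBits (w L a : ℕ) : ℕ := ones w L * (2 ^ (w - a) - 1)

/-- Subtracts from each lane `v` of `V` the multiple `p * ⌊⌊v / 2 ^ a⌋ * c / 2 ^ s⌋` of `p`, where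
`c = ⌊2 ^ (a + s) / p⌋`. -/
def barrett (p w L a s V : ℕ) : ℕ :=
  Nat.sub V (Nat.mul p (Nat.land (Nat.shiftRight
    (Nat.mul (Nat.land (Nat.shiftRight V a) (lowBits w L a)) (2 ^ (a + s) / p)) s)
    (lowBits w L s)))

/-- Subtracts `p` from each of the `L` lanes of `V` that is at least `p`. -/
def condSub (p w L b V : ℕ) : ℕ :=
  Nat.sub V (Nat.mul p (Nat.land
    (Nat.shiftRight (Nat.add V (ones w L * (2 ^ (b + 1) - p))) (b + 1)) (ones w L)))

/-- Reduces the `L` lanes of `V` modulo `p`, where `p` has `b` bits: two rounds of Barrett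
reduction and a conditional subtraction. No property of this function is used: its values are
candidates, which `mulCheck` validates. -/
def reduce (p r w b L V : ℕ) : ℕ :=
  condSub p w L b (barrett p w L (b - 2) (r + 8) (barrett p w L (b - 1) (b - 1) V))

/-- Certifies `U * V + S ≡ R` modulo `p` for packed polynomials. The operands have small lanes, so
that no carries occur on either side of the equality `U * V + S = R + p * Q` of natural numbers. -/
def mulCheck (p r w b U V S R : ℕ) : Bool :=
  force (Nat.add (Nat.mul U V) S) fun M =>
  force (Nat.div (Nat.sub M R) p) fun Q =>
    Nat.beq (Nat.add R (Nat.mul p Q)) M && (lanesLt w (2 ^ (r + 1)) b U &&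
      (lanesLt w (2 ^ r) b V && (lanesLt w (2 ^ (r + 1)) b S &&
        (lanesLt w (2 ^ (r + 1)) b R && lanesLt w (2 ^ (r + 1)) (w - b - 1) Q))))

/-- The conditions under which lanes of `w` bits can hold the coefficients of a product of two
polynomials with coefficients below `2 ^ b`, one of which has at most `2 ^ r` terms. -/
structure LaneBounds (p r w b : ℕ) : Prop where
  one_lt : 1 < p
  lt_two_pow : p < 2 ^ b
  succ_le : b + 1 ≤ w
  mul_le : 2 ^ r * (2 ^ b * 2 ^ b) + 2 ^ b ≤ 2 ^ w

variable {p r w b : ℕ}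

theorem LaneBounds.width_pos (h : LaneBounds p r w b) : 0 < w :=
  (Nat.succ_pos b).trans_le h.succ_le

open Polynomial in
theorem coeff_mul_le {P Q : ℕ[X]} {N B : ℕ} (hP : ∀ i, P.coeff i ≤ B) (hQ : ∀ i, Q.coeff i ≤ B)
    (hN : ∀ i, N ≤ i → Q.coeff i = 0) (n : ℕ) : (P * Q).coeff n ≤ N * (B * B) := by
  rw [mul_comm, coeff_mul, Nat.sum_antidiagonal_eq_sum_range_succ_mk]
  calc ∑ j ∈ range n.succ, Q.coeff j * P.coeff (n - j)
      ≤ ∑ j ∈ range n.succ, if j ∈ range N then B * B else 0 := by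
        refine sum_le_sum fun j _ => ?_
        split_ifs with h
        · exact Nat.mul_le_mul (hQ _) (hP _)
        · rw [hN j (by simpa using h), zero_mul]
    _ ≤ ∑ j ∈ range N, B * B := by
        rw [← sum_filter]
        exact sum_le_sum_of_subset (fun j hj => (mem_filter.1 hj).2)
    _ = N * (B * B) := by simp

open Polynomial in
theorem mulCheck_spec (hb : LaneBounds p r w b) {U V S R : ℕ}
    (h : mulCheck p r w b U V S R = true) :
    unpack p w U * unpack p w V + unpack p w S = unpack p w R := by
  have hw := hb.width_pos
  have hbw : b ≤ w := (Nat.le_succ b).trans hb.succ_le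
  simp only [mulCheck, force_eq, Bool.and_eq_true, Nat.beq_eq] at h
  set Q := Nat.div (Nat.sub (Nat.add (Nat.mul U V) S) R) p
  obtain ⟨hQ, hU, hV, hS, hR, hQ'⟩ := h
  have hQ : R + p * Q = U * V + S := hQ
  have hU := (lanesLt_spec hw hbw hU).2
  obtain ⟨hVN, hV⟩ := lanesLt_spec hw hbw hV
  have hS := (lanesLt_spec hw hbw hS).2
  have hR := (lanesLt_spec hw hbw hR).2
  have hQ' := (lanesLt_spec hw (by omega) hQ').2
  have h1 : lanes w R + C p * lanes w Q = lanes w U * lanes w V + lanes w S := by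
    rw [← lanes_eval hw (P := lanes w R + C p * lanes w Q),
      ← lanes_eval hw (P := lanes w U * lanes w V + lanes w S)]
    · simp only [eval_add, eval_mul, eval_C, eval_lanes hw, hQ]
    · intro i
      rw [coeff_add]
      calc _ < 2 ^ r * (2 ^ b * 2 ^ b) + 2 ^ b :=
            add_lt_add_of_le_of_lt (coeff_mul_le (fun i => (hU i).le) (fun i => (hV i).le)
              (fun i hi => coeff_lanes_eq_zero hw hVN hi) i) (hS i)
        _ ≤ 2 ^ w := hb.mul_le
    · intro i
      rw [coeff_add, coeff_C_mul]
      have h2 : p * (lanes w Q).coeff i ≤ 2 ^ b * 2 ^ (w - b - 1) :=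
        Nat.mul_le_mul hb.lt_two_pow.le (hQ' i).le
      have h3 : 2 ^ b * 2 ^ (w - b - 1) = 2 ^ (w - 1) := by
        rw [← pow_add]; congr 1; have := hb.succ_le; omega
      have h4 : 2 ^ b ≤ 2 ^ (w - 1) :=
        Nat.pow_le_pow_right two_pos (by have := hb.succ_le; omega)
      have h5 : 2 ^ w = 2 ^ (w - 1) + 2 ^ (w - 1) := by
        rw [← two_mul, ← pow_succ', Nat.sub_add_cancel hw]
      have := hR i
      omega
  have h2 := congrArg (Polynomial.map (Nat.castRingHom (ZMod p))) h1
  simpa [unpack] using h2.symm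

theorem lt_of_mulCheck (hb : LaneBounds p r w b) {U V S R : ℕ}
    (h : mulCheck p r w b U V S R = true) : V < 2 ^ (w * 2 ^ r) := by
  simp only [mulCheck, force_eq, Bool.and_eq_true] at h
  exact (lanesLt_spec hb.width_pos ((Nat.le_succ b).trans hb.succ_le) h.2.2.1).1

/-! ### Certified computation of `halfSum` -/

/-- Computes `bitProd`. Given packings `W` of `(1 - X) ^ 2 ^ i` and `P` of `bitProd p k i`, runs
through the next `n` binary digits of `k` and passes the resulting product to `f`. -/
def withBitProd (p r w b k : ℕ) : ℕ → ℕ → ℕ → ℕ → (ℕ → Bool) → Bool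
  | 0, _, _, P, f => f P
  | n + 1, i, W, P, f =>
    force (reduce p r w b (2 ^ r + 1) (Nat.mul W W)) fun W' =>
    mulCheck p r w b W W 0 W' && bif k.testBit i then
      force (reduce p r w b (2 ^ r + 1)
        (Nat.add (Nat.mul P W) (Nat.shiftLeft P (w * 2 ^ i)))) fun P' =>
      mulCheck p r w b P W (Nat.shiftLeft P (w * 2 ^ i)) P' &&
        withBitProd p r w b k n (i + 1) W' P' f
    else withBitProd p r w b k n (i + 1) W' P f

/-- Newton iteration for the inverse of the power series packed in `D`: doubles `n` times the
precision of the approximation `E`. No property of this function is used. -/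
def invApprox (p r w b D : ℕ) : ℕ → ℕ → ℕ → ℕ
  | 0, _, E => E
  | n + 1, l, E =>
    force (lowLanes w l (reduce p r w b l (lowLanes w l (Nat.mul (lowLanes w l D) E)))) fun T =>
    force (lowLanes w l (reduce p r w b l (lowLanes w l
      (Nat.mul E (Nat.sub (ones w l * p + 2) T))))) fun E' =>
    invApprox p r w b D n (2 * l) E'

/-- Runs `t` steps of the division of `C` by `D` as power series, where `E` approximates the
inverse of `D`. Each step computes the next `2 ^ r` coefficients `B` of the quotient and replaces
`C` by `(C - D * B) / X ^ 2 ^ r`. The predicate `test` is applied to each `B`, together with the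
number of steps still to follow. -/
def blockCheck (p r w b D E : ℕ) (test : ℕ → ℕ → Bool) : ℕ → ℕ → Bool
  | 0, _ => true
  | t + 1, C =>
    force (reduce p r w b (2 ^ r) (lowLanes w (2 ^ r) (Nat.mul C E))) fun B =>
    force (Nat.sub (ones w (2 ^ r) * p)
      (reduce p r w b (2 ^ r) (Nat.shiftRight (Nat.mul D B) (w * 2 ^ r)))) fun C' =>
    mulCheck p r w b D B (Nat.shiftLeft C' (w * 2 ^ r)) C &&
      (test t B && blockCheck p r w b D E test t C')

/-- Computes the first `m * 2 ^ r` terms of `halfSum p k` in blocks of `2 ^ r` terms and applies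
`test` to each block. -/
def halfSumCheck (p r w b m : ℕ) (test : ℕ → ℕ → Bool) (k : ℕ) : Bool :=
  force (1 + (p - 1) * 2 ^ w) fun W =>
  mulCheck p r w b (p - 1) (1 * 2 ^ (w * 1)) 1 W && withBitProd p r w b k r 0 W 1 fun P =>
  force (reduce p r w b (2 ^ r + 1)
    (Nat.add P (Nat.mul (p - 2) (Nat.shiftLeft P w)))) fun D =>
  mulCheck p r w b P ((p - 2) * 2 ^ (w * 1)) P D &&
  force (reduce p r w b (2 ^ r) (Nat.add P ((p - 1) * 2 ^ (w * (k - 1))))) fun C =>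
  mulCheck p r w b P 1 ((p - 1) * 2 ^ (w * (k - 1))) C &&
  force (invApprox p r w b D r 2 1) fun E =>
  blockCheck p r w b D E test m C

open Polynomial

theorem unpack_zero (p w : ℕ) : unpack p w 0 = 0 := by simp [unpack, lanes]

theorem unpack_one (hw : 0 < w) : unpack p w 1 = 1 := by
  rw [unpack_of_lt hw (Nat.one_lt_two_pow hw.ne'), Nat.cast_one, C_1]

theorem unpack_shiftLeft (hw : 0 < w) (V n : ℕ) :
    unpack p w (Nat.shiftLeft V (w * n)) = unpack p w V * X ^ n := by
  rw [← unpack_mul_two_pow hw]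
  congr 1
  exact Nat.shiftLeft_eq _ _

theorem unpack_sub (hb : LaneBounds p r w b) {c : ℕ} (hc : c ≤ p) :
    unpack p w (p - c) = -C (c : ZMod p) := by
  have h : p < 2 ^ w := hb.lt_two_pow.trans_le
    (Nat.pow_le_pow_right two_pos ((Nat.le_succ b).trans hb.succ_le))
  rw [unpack_of_lt hb.width_pos ((Nat.sub_le _ _).trans_lt h), Nat.cast_sub hc, CharP.cast_eq_zero,
    zero_sub, C_neg]

theorem withBitProd_spec (hb : LaneBounds p r w b) (k : ℕ) {f : ℕ → Bool} (n : ℕ) {i W P : ℕ}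
    (h : withBitProd p r w b k n i W P f = true) (hW : unpack p w W = (1 - X) ^ 2 ^ i)
    (hP : unpack p w P = bitProd p k i) :
    ∃ P', unpack p w P' = bitProd p k (i + n) ∧ f P' = true := by
  induction n generalizing i W P with
  | zero => exact ⟨P, hP, h⟩
  | succ n ih =>
    rw [withBitProd] at h
    simp only [force_eq, Bool.and_eq_true] at h
    obtain ⟨h1, h2⟩ := h
    have hW' := mulCheck_spec hb h1
    rw [unpack_zero, add_zero, hW, ← pow_add, ← two_mul, ← pow_succ'] at hW'
    rw [← add_assoc, add_right_comm]
    cases hk : k.testBit i with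
    | true =>
      simp only [hk, cond_true, Bool.and_eq_true] at h2
      have hP' := mulCheck_spec hb h2.1
      refine ih h2.2 hW'.symm (hP'.symm.trans ?_)
      rw [unpack_shiftLeft hb.width_pos, hW, hP, bitProd, bitProd, prod_range_succ, if_pos hk]
      ring
    | false =>
      simp only [hk, cond_false] at h2
      refine ih h2 hW'.symm (hP.trans ?_)
      rw [bitProd, bitProd, prod_range_succ, hk]
      simp

theorem blockCheck_spec (hb : LaneBounds p r w b) {D E : ℕ} {test : ℕ → ℕ → Bool}
    {d : PowerSeries (ZMod p)} (hd : (unpack p w D : PowerSeries (ZMod p)) * d = 1) (m : ℕ) {C : ℕ}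
    (h : blockCheck p r w b D E test m C = true) {F : PowerSeries (ZMod p)}
    (hF : (unpack p w D : PowerSeries (ZMod p)) * F = unpack p w C) {t : ℕ} (ht : t < m) :
    ∃ B, test (m - 1 - t) B = true ∧ ∀ j < 2 ^ r,
      PowerSeries.coeff (t * 2 ^ r + j) F = ((lanes w B).coeff j : ZMod p) := by
  induction m generalizing C F t with
  | zero => omega
  | succ m ih =>
    rw [blockCheck] at h
    simp only [force_eq, Bool.and_eq_true] at h
    set B := reduce p r w b (2 ^ r) (lowLanes w (2 ^ r) (Nat.mul C E))
    set C' := Nat.sub (ones w (2 ^ r) * p)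
      (reduce p r w b (2 ^ r) (Nat.shiftRight (Nat.mul D B) (w * 2 ^ r)))
    obtain ⟨h1, h2, h3⟩ := h
    have hB := lt_of_mulCheck hb h1
    have h1 := mulCheck_spec hb h1
    rw [unpack_shiftLeft hb.width_pos] at h1
    -- the quotient is `B + X ^ 2 ^ r * G`, where `G` is the quotient of `C'`
    set G : PowerSeries (ZMod p) := d * unpack p w C' with hG
    have hDG : (unpack p w D : PowerSeries (ZMod p)) * G = unpack p w C' := by
      rw [hG, ← mul_assoc, hd, one_mul]
    have hFG : F = (unpack p w B : PowerSeries (ZMod p)) + PowerSeries.X ^ 2 ^ r * G := by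
      have h1' := congrArg (fun P : (ZMod p)[X] => (P : PowerSeries (ZMod p))) h1
      push_cast at h1'
      rw [hG]
      linear_combination (-F + (unpack p w B : PowerSeries (ZMod p))) * hd + d * hF - d * h1'
    rcases t with _ | t
    · refine ⟨B, h2, fun j hj => ?_⟩
      rw [zero_mul, zero_add, hFG, map_add, PowerSeries.coeff_X_pow_mul', if_neg (not_le.2 hj),
        add_zero, coeff_coe, coeff_unpack]
    · obtain ⟨B', hB', hB''⟩ := ih h3 hDG (Nat.lt_of_succ_lt_succ ht)
      refine ⟨B', by rwa [show m + 1 - 1 - (t + 1) = m - 1 - t by omega], fun j hj => ?_⟩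
      have e : (t + 1) * 2 ^ r + j = t * 2 ^ r + j + 2 ^ r := by ring
      rw [← hB'' j hj, hFG, e, map_add, PowerSeries.coeff_X_pow_mul, coeff_coe, coeff_unpack,
        coeff_lanes_eq_zero hb.width_pos hB (Nat.le_add_left _ _), Nat.cast_zero, zero_add]

theorem exists_mul_denPoly_eq_one (p k s : ℕ) :
    ∃ d : PowerSeries (ZMod p), (denPoly p k s : PowerSeries (ZMod p)) * d = 1 := by
  refine ⟨PowerSeries.invOfUnit _ 1, PowerSeries.mul_invOfUnit _ _ ?_⟩
  rw [Polynomial.constantCoeff_coe, denPoly, bitProd, Units.val_one, mul_coeff_zero,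
    coeff_zero_prod]
  rw [prod_eq_one]
  · simp
  · intro i _
    split_ifs <;> simp [coeff_zero_eq_eval_zero]

theorem halfSumCheck_spec (hb : LaneBounds p r w b) {m k : ℕ} {test : ℕ → ℕ → Bool} (hk1 : 1 ≤ k)
    (hk : k < 2 ^ r) (h : halfSumCheck p r w b m test k = true) {t : ℕ} (ht : t < m) :
    ∃ B, test (m - 1 - t) B = true ∧
      ∀ j < 2 ^ r, halfSum p k (t * 2 ^ r + j) = ((lanes w B).coeff j : ZMod p) := by
  have hw := hb.width_pos
  simp only [halfSumCheck, force_eq, Bool.and_eq_true] at h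
  obtain ⟨hW, h⟩ := h
  have hW := mulCheck_spec hb hW
  rw [unpack_mul_two_pow hw, unpack_one hw, unpack_sub hb hb.one_lt.le] at hW
  obtain ⟨P, hP, h⟩ := withBitProd_spec hb k r h (by rw [← hW]; simp; ring)
    (by rw [unpack_one hw]; simp [bitProd])
  rw [zero_add] at hP
  simp only [Bool.and_eq_true] at h
  obtain ⟨hD, hC, h⟩ := h
  have hD := mulCheck_spec hb hD
  have hC := mulCheck_spec hb hC
  rw [unpack_mul_two_pow hw, unpack_sub hb (show 2 ≤ p from hb.one_lt), hP] at hD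
  rw [unpack_mul_two_pow hw, unpack_sub hb hb.one_lt.le, hP, unpack_one hw] at hC
  have hD : _ = denPoly p k r := hD.symm.trans (by
    rw [denPoly, Nat.cast_ofNat, map_ofNat]; ring)
  have hC : _ = bitProd p k r - X ^ (k - 1) := hC.symm.trans (by simp; ring)
  obtain ⟨d, hd⟩ := exists_mul_denPoly_eq_one p k r
  rw [← hD] at hd
  have hF := denPoly_mul_halfSeries (p := p) hk1 hk
  rw [← hD, ← hC] at hF
  obtain ⟨B, h1, h2⟩ := blockCheck_spec hb hd m h hF ht
  refine ⟨B, h1, fun j hj => ?_⟩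
  rw [← h2 j hj, halfSeries, PowerSeries.coeff_mk]

/-- Checks that the first `2 ^ r` lanes of `B` lie strictly between `0` and `p`. -/
def testNonzero (p r w b : ℕ) (_t B : ℕ) : Bool :=
  force (Nat.sub B (ones w (2 ^ r))) fun B' =>
    Nat.beq B (Nat.add B' (ones w (2 ^ r))) && (lanesLt w (2 ^ r) b B' &&
      lanesLt w (2 ^ r) b (Nat.add B' ((2 ^ b + 1 - p) * ones w (2 ^ r))))

theorem testNonzero_spec (hb : LaneBounds p r w b) {t B : ℕ}
    (h : testNonzero p r w b t B = true) {j : ℕ} (hj : j < 2 ^ r) :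
    ((lanes w B).coeff j : ZMod p) ≠ 0 := by
  have hw := hb.width_pos
  have hbw : b ≤ w := (Nat.le_succ b).trans hb.succ_le
  have h2w : 2 ^ b + 2 ^ b ≤ 2 ^ w := by
    rw [← two_mul, ← pow_succ']; exact Nat.pow_le_pow_right two_pos hb.succ_le
  have hp := hb.one_lt
  have hpb := hb.lt_two_pow
  simp only [testNonzero, force_eq, Bool.and_eq_true, Nat.beq_eq] at h
  set B' := Nat.sub B (ones w (2 ^ r))
  obtain ⟨h1, h2, h3⟩ := h
  have h2 := (lanesLt_spec hw hbw h2).2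
  have h3 := (lanesLt_spec hw hbw h3).2
  -- adding a constant to all lanes causes no carries
  have key : ∀ c ≤ 2 ^ b, (lanes w (B' + c * ones w (2 ^ r))).coeff j =
      (lanes w B').coeff j + c := by
    intro c hc
    have hones : ∀ i, (∑ i ∈ range (2 ^ r), (X : ℕ[X]) ^ i).coeff i =
        if i < 2 ^ r then 1 else 0 := by
      intro i
      simp [finsetSum_coeff, coeff_X_pow]
    have hcoeff : ∀ i, (lanes w B' + C c * ∑ i ∈ range (2 ^ r), X ^ i).coeff i =
        (lanes w B').coeff i + if i < 2 ^ r then c else 0 := by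
      intro i
      rw [coeff_add, coeff_C_mul, hones]
      simp
    have := lanes_eval hw (P := lanes w B' + C c * ∑ i ∈ range (2 ^ r), X ^ i) (by
      intro i
      rw [hcoeff]
      have := h2 i
      split_ifs <;> omega)
    rw [eval_add, eval_lanes hw, eval_mul, eval_C, eval_finsetSum] at this
    simp only [eval_pow, eval_X] at this
    rw [← ones_eq hw] at this
    rw [this, hcoeff, if_pos hj]
  have hB : B = B' + 1 * ones w (2 ^ r) := by rw [one_mul]; exact h1
  have h4 := h3 j
  change (lanes w (B' + (2 ^ b + 1 - p) * ones w (2 ^ r))).coeff j < _ at h4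
  rw [key _ (by omega)] at h4
  rw [hB, key 1 (Nat.one_le_two_pow), Ne, ZMod.natCast_eq_zero_iff]
  exact Nat.not_dvd_of_pos_of_lt (Nat.succ_pos _) (by omega)

/-- Checks, `t₀` steps before the end, that the lane `j` of `B` is zero. -/
def testZero (w t₀ j : ℕ) (t B : ℕ) : Bool :=
  bif Nat.beq t t₀ then Nat.beq (Nat.shiftRight B (w * j) % 2 ^ w) 0 else true

theorem testZero_spec (hw : 0 < w) {t j B : ℕ} (h : testZero w t j t B = true) :
    (lanes w B).coeff j = 0 := by
  have hbeq : Nat.beq t t = true := Nat.beq_refl t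
  rw [testZero, hbeq, cond_true, Nat.beq_eq] at h
  rw [coeff_lanes hw, ← pow_mul, ← Nat.shiftRight_eq_div_pow]
  exact h

end Packed

/-! ### Certificates of avoidance -/

section Certificates

theorem prime_of_forall_not_dvd {p s : ℕ} (h2 : 2 ≤ p) (hs : p < s * s)
    (h : ∀ d < s, 2 ≤ d → d < p → ¬ d ∣ p) : p.Prime := by
  by_contra hp
  have h1 : p.minFac ^ 2 ≤ p := Nat.minFac_sq_le_self (by omega) hp
  have h3 : 2 ≤ p.minFac := (Nat.minFac_prime (by omega)).two_le
  have h4 : p.minFac < s := by nlinarith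
  exact h _ h4 h3 (by nlinarith) (Nat.minFac_dvd p)

/-- The number of binary digits of `p`. -/
def coeffBits (p : ℕ) : ℕ := Nat.log2 p + 1

/-- A lane width sufficient for the computations modulo `p` with `2 ^ r` lanes, including the
candidates computed by `reduce`. -/
def laneBits (p r : ℕ) : ℕ := max (r + 2 * coeffBits p + 2) (2 * r + 13)

/-- Checks that `p` is a prime congruent to one modulo `2 ^ r`. The bound `420` suffices for trial
division of the primes that occur here. -/
def primeCheck (p r : ℕ) : Bool :=
  Nat.ble 2 p && (Nat.ble (p + 1) (420 * 420) && (Nat.beq (p % 2 ^ r) 1 &&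
    (List.range 420).all fun d => Nat.ble d 1 || (Nat.ble p d || !Nat.beq (p % d) 0)))

theorem primeCheck_spec {p r : ℕ} (h : primeCheck p r = true) : p.Prime ∧ p % 2 ^ r = 1 := by
  simp only [primeCheck, Bool.and_eq_true, Nat.ble_eq, Nat.beq_eq, List.all_eq_true,
    List.mem_range, Bool.or_eq_true, Bool.not_eq_true'] at h
  obtain ⟨h1, h2, h3, h4⟩ := h
  refine ⟨prime_of_forall_not_dvd h1 h2 fun d hd hd2 hdp hdvd => ?_, h3⟩
  rcases h4 d hd with h | h | h
  · omega
  · omega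
  · simp [Nat.mod_eq_zero_of_dvd hdvd] at h

/-- Checks the inequalities of `LaneBounds`. -/
def boundsCheck (p r w b : ℕ) : Bool :=
  decide (1 < p ∧ p < 2 ^ b ∧ b + 1 ≤ w ∧ 2 ^ r * (2 ^ b * 2 ^ b) + 2 ^ b ≤ 2 ^ w)

theorem boundsCheck_spec {p r w b : ℕ} (h : boundsCheck p r w b = true) : LaneBounds p r w b := by
  obtain ⟨h1, h2, h3, h4⟩ := of_decide_eq_true h
  exact ⟨h1, h2, h3, h4⟩

/-- Checks `f i` for all `i < n` such that bit `i` of `mask` is set. -/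
def allBits (f : ℕ → Bool) (mask : ℕ) : ℕ → Bool
  | 0 => true
  | n + 1 => (bif mask.testBit n then f n else true) && allBits f mask n

theorem allBits_spec {f : ℕ → Bool} {mask n : ℕ} (h : allBits f mask n = true) {i : ℕ} (hi : i < n)
    (hm : mask.testBit i = true) : f i = true := by
  induction n with
  | zero => omega
  | succ n ih =>
    rw [allBits, Bool.and_eq_true] at h
    rcases Nat.lt_succ_iff_lt_or_eq.1 hi with hi | rfl
    · exact ih h.2 hi
    · simpa [hm] using h.1

/-- A prime `p` together with the set of all `k = 2 ^ (r - 1) + i`, for `i` a binary digit of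
`mask` equal to one, for which `p` is claimed to be avoided. -/
structure Certificate where
  r : ℕ
  p : ℕ
  mask : ℕ

/-- Checks the claim of a certificate, by computing a full period of `halfSum`. -/
def Certificate.check (c : Certificate) : Bool :=
  primeCheck c.p c.r &&
  force (coeffBits c.p) fun b => force (laneBits c.p c.r) fun w =>
  boundsCheck c.p c.r w b &&
  force (c.p / 2 ^ c.r) fun m =>
  allBits (fun i => force (2 ^ (c.r - 1) + i) (halfSumCheck c.p c.r w b m (testNonzero c.p c.r w b)))
    c.mask (2 ^ (c.r - 1))

theorem Certificate.check_spec {c : Certificate} (hr : 1 ≤ c.r) (h : c.check = true) {i : ℕ}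
    (hi : i < 2 ^ (c.r - 1)) (hi0 : 0 < i) (hm : c.mask.testBit i = true) :
    c.p ∈ avoidedPrimes (2 ^ (c.r - 1) + i) := by
  obtain ⟨r, p, mask⟩ := c
  simp only [Certificate.check, force_eq, Bool.and_eq_true] at h hi hm ⊢
  obtain ⟨hp, hb, h⟩ := h
  obtain ⟨hp, hmod⟩ : p.Prime ∧ p % 2 ^ r = 1 := primeCheck_spec hp
  have hb := boundsCheck_spec hb
  have h := allBits_spec h hi hm
  have hpow : 2 ^ r = 2 * 2 ^ (r - 1) := by rw [← pow_succ', Nat.sub_add_cancel hr]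
  have hk : 2 ^ (r - 1) + i < 2 ^ r := by omega
  set m := p / 2 ^ r
  have hpm : p = 2 ^ r * m + 1 := by
    have := Nat.div_add_mod p (2 ^ r)
    rw [hmod] at this
    exact this.symm
  have hm0 : 0 < m := by
    rcases Nat.eq_zero_or_pos m with h0 | h0
    · rw [h0] at hpm; exact absurd hpm (by have := hp.two_le; omega)
    · exact h0
  have hp2 : p ≠ 2 := by
    rintro rfl
    rw [hpow, mul_assoc] at hpm
    omega
  have := Fact.mk hp
  refine ⟨hp, ⟨r, m, by omega, hk, hm0, hpm⟩, ?_⟩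
  refine avoids_of_halfSum_ne_zero hp2 (by omega) hk ⟨m, by omega⟩ fun n hn => ?_
  have hN : 0 < 2 ^ r := by positivity
  have ht : n / 2 ^ r < m := by
    rw [Nat.div_lt_iff_lt_mul hN, mul_comm]
    omega
  obtain ⟨B, hB, hB'⟩ := halfSumCheck_spec hb (by omega) hk h ht
  have h1 := hB' (n % 2 ^ r) (Nat.mod_lt _ hN)
  rw [mul_comm, Nat.div_add_mod] at h1
  rw [h1]
  exact testNonzero_spec hb hB (Nat.mod_lt _ hN)

/-- Checks `halfSum p k n = 0`, where `k < 2 ^ r`. -/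
def zeroCheck (r k p n : ℕ) : Bool :=
  force (coeffBits p) fun b => force (laneBits p r) fun w =>
  boundsCheck p r w b &&
  halfSumCheck p r w b (n / 2 ^ r + 1) (testZero w 0 (n % 2 ^ r)) k

theorem zeroCheck_spec {r k p n : ℕ} (hk1 : 1 ≤ k) (hk : k < 2 ^ r)
    (h : zeroCheck r k p n = true) : halfSum p k n = 0 := by
  simp only [zeroCheck, force_eq, Bool.and_eq_true] at h
  have hb := boundsCheck_spec h.1
  obtain ⟨B, hB, hB'⟩ := halfSumCheck_spec hb hk1 hk h.2 (Nat.lt_succ_self (n / 2 ^ r))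
  have h1 := hB' (n % 2 ^ r) (Nat.mod_lt _ (by positivity))
  rw [mul_comm, Nat.div_add_mod] at h1
  rw [h1]
  rw [show n / 2 ^ r + 1 - 1 - n / 2 ^ r = 0 by omega] at hB
  rw [testZero_spec hb.width_pos hB, Nat.cast_zero]

end Certificates

/-! ### The certificates and the theorem -/

/-- Certificates for all `k < 2048` that are not powers of two, in batches of bounded total cost.
In each entry the mask records the `k` to which the prime is assigned. -/
def certificates : List (List Certificate) :=
  [[⟨2, 5, 0x2⟩,
   ⟨3, 17, 0x2⟩,
   ⟨3, 41, 0x4⟩,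
   ⟨3, 73, 0x8⟩,
   ⟨4, 17, 0xfc⟩,
   ⟨4, 97, 0x2⟩,
   ⟨5, 97, 0xe79c⟩,
   ⟨5, 193, 0x800⟩,
   ⟨5, 257, 0x1040⟩,
   ⟨5, 449, 0x20⟩,
   ⟨5, 1601, 0x2⟩,
   ⟨6, 193, 0x80e79174⟩,
   ⟨6, 257, 0x1d084880⟩,
   ⟨6, 449, 0x22102202⟩,
   ⟨6, 641, 0x40000000⟩,
   ⟨6, 769, 0x400⟩,
   ⟨6, 1409, 0x8⟩,
   ⟨7, 257, 0x5759d289f875d124⟩,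
   ⟨7, 641, 0x80a20820040a2290⟩,
   ⟨7, 769, 0x800041600000448⟩,
   ⟨7, 1153, 0x2000014000000002⟩,
   ⟨7, 1409, 0x800⟩,
   ⟨7, 2689, 0x3000000⟩,
   ⟨7, 3329, 0x4200000800000⟩,
   ⟨8, 257, 0xfff9ffddff7dfd9dff7cfe91fdadcc88⟩,
   ⟨8, 769, 0x40020000002020080010800002016⟩,
   ⟨8, 3329, 0x2000200000002004200401060⟩,
   ⟨8, 7681, 0x2020100⟩,
   ⟨8, 7937, 0x20000000000200001002000100200⟩,
   ⟨8, 9473, 0x8000000000000400000000⟩,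
   ⟨8, 10753, 0x400000000000000000⟩,
   ⟨9, 7681, 0x7949fab86b2f51a182cdaf2b8e67105300c0d8238b2ad2584d86dec08445574e⟩,
   ⟨9, 10753, 0x20c000f0158501021008251200a21128880⟩],
  [⟨9, 10753, 0x430014484c0a01e0c20409050886c0000000000000000000000000000000000⟩,
   ⟨9, 11777, 0x82000300000200010000042100800004000404040008002000001042002000⟩,
   ⟨9, 12289, 0x204000010000000200000400010012090000200000000230020000000080000⟩,
   ⟨9, 13313, 0x101000000000000001100000204504000000000110200000⟩,
   ⟨9, 15361, 0x40000000440000200000000000022000080000000001008002000000010⟩,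
   ⟨9, 17921, 0x100000400000000000000008200000000000800000000400000000⟩,
   ⟨9, 18433, 0x8000000000000800000000000000000040002000008000040000010000800000⟩,
   ⟨9, 19457, 0x10000000008000000000000000000000000008000020⟩],
  [⟨10, 12289, 0x227229d0f0aced553188cae081a8a0a12889c86494c1482a36f1fa8cc552d8f0904c5440a⟩],
  [⟨10, 12289, 0x2e213f2404340a9314821098a58d8a20014a00183404a3e9405d06f4000000000000000000000000000000000000000000000000000000000000000000000000⟩,
   ⟨10, 13313, 0x21066800480412401082201a024488000403100405044c0022120⟩],
  [⟨10, 13313, 0x508880d3db4304640959290442706580c2006460001b44040f202900000802404001228806200000000000000000000000000000000000000000000000000000⟩,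
   ⟨10, 15361, 0xc0242000490010010108013028a12203012008094⟩],
  [⟨10, 15361, 0x14240082080300000004200100200020011128780001012b0809008c0c4600011300800e0004010045040a00000000000000000000000000000000000000000⟩,
   ⟨10, 18433, 0x8e02004000000100c302088000300000000024000181000108000002000100080200101000000600000005100004004000080008020000000⟩],
  [⟨10, 18433, 0x40000000080000000000000000000000000000000000000000000000000000000000000000000000000000000000000000000000000000000000000000000⟩,
   ⟨10, 19457, 0x1000000008410002000000080000500080000000000000000000000000000024000004000000000000100011200190220a0004002000000000000200101000⟩,
   ⟨10, 25601, 0x8041000000000c0000004840080000000001000000200000000000400101400004000000000000400000000000000000000000000240⟩,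
   ⟨10, 37889, 0x80000000000000000000002200000000000000000000000000000000000000800000000000000000000000004000000000000000000000000000000000000000⟩,
   ⟨10, 39937, 0x4000000000000000400000000000000000000000000000000000000000000012000000000000000000800000000000000000008080800⟩,
   ⟨10, 40961, 0x80000000000000000000000000000000000000000020000000100000000000000000000000000000000000⟩,
   ⟨10, 50177, 0x200000⟩],
  [⟨10, 50177, 0x1000000000000000000000000000000000000010000000000000000000000000000000000000000000000000000⟩,
   ⟨10, 58369, 0x1000000000000000000000000000000000000000001000000000000000000000000000000000000002000000000000000⟩,
   ⟨10, 61441, 0x1000000⟩,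
   ⟨10, 65537, 0x100000000000000000000000000000000000000000000000000000000000000000000⟩,
   ⟨10, 79873, 0x20000000000000000000000000000000000000000000000000000000000000000000000000000000000000⟩],
  [⟨11, 12289, 0x3114f202485811d5c306429168403321d3381a56af40551d012d84d8303a⟩],
  [⟨11, 12289, 0x21eefcfc1cb3470229c6769876b31a46ba30c3c06007450f4400000000000000000000000000000000000000000000000000000000000⟩],
  [⟨11, 12289, 0xa94b007d0de025603b312095ea0754f0cc9b82642a087254daa0e4c000000000000000000000000000000000000000000000000000000000000000000000000000000000000000000000000000000000000⟩],
  [⟨11, 12289, 0x9aa1152cc80c3983024a5cfc2120650022a62f0a94565c6ea44aaf1860000000000000000000000000000000000000000000000000000000000000000000000000000000000000000000000000000000000000000000000000000000000000000000000000000000000000000000⟩],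
  [⟨11, 12289, 0x18348d9b251ced5b3101f1a0953b688d84190000000000000000000000000000000000000000000000000000000000000000000000000000000000000000000000000000000000000000000000000000000000000000000000000000000000000000000000000000000000000000000000000000000000000000000000000000⟩,
   ⟨11, 18433, 0x448120400882601c802002c980⟩],
  [⟨11, 18433, 0x10010060040075400101208808200901c10c0610981870900800c4427064c201440296c0080c80c0480000000000000000000000000⟩],
  [⟨11, 18433, 0xa08a30140040000904043d8232014a94008c5e4a1100030820447582013385a00008031400000000000000000000000000000000000000000000000000000000000000000000000000000000000000000000000000000000000⟩],
  [⟨11, 18433, 0x2c21000041c02112840141038620414e8d224e084645c90000140d1808f0c005055200000000000000000000000000000000000000000000000000000000000000000000000000000000000000000000000000000000000000000000000000000000000000000000000000000000000000000000000000000000000⟩],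
  [⟨11, 18433, 0x434a206058000000000000000000000000000000000000000000000000000000000000000000000000000000000000000000000000000000000000000000000000000000000000000000000000000000000000000000000000000000000000000000000000000000000000000000000000000000000000000000000000000000⟩,
   ⟨11, 40961, 0x886000001020200008000000041204120800008000a52802c2001a050640⟩],
  [⟨11, 40961, 0x4000000490000003000801d04400082014000801020182001088062800040144012000080000044020002000000000000000000000000000000000000000000000000000000000000⟩],
  [⟨11, 40961, 0xa02000040428020000001010040000104200082021010101800000000009001011040050200200401c900a400000000000000000000000000000000000000000000000000000000000000000000000000000000000000000000000000000000000000000000000000000000000000000000000000⟩],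
  [⟨11, 40961, 0x24001200000002004ac00c400000000000000000000000000000000000000000000000000000000000000000000000000000000000000000000000000000000000000000000000000000000000000000000000000000000000000000000000000000000000000000000000000000000000000000000000000000000000000000⟩,
   ⟨11, 59393, 0x880001000820880400002500800000400110000080005000200004⟩],
  [⟨11, 59393, 0x400000280000080000000000080000048a80500200000000000000041080000000001088000100080010000448040000000080002800000100000000000000000000000000000000000000000000000000000000⟩],
  [⟨11, 59393, 0x4800000a4002000004080800000040140020002000200002101001004086081400000418100000000000000000000000000000000000000000000000000000000000000000000000000000000000000000000000000000000000000000000000000000000000000000000000000000000000000000000000000000000⟩],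
  [⟨11, 59393, 0x400000000000000000000000000000000000000000000000000000000000000000000000000000000000000000000000000000000000000000000000000000000000000000000000000000000000000000000000000000000000000000000000000000000000000000000000000000000000000000000000000000000000⟩,
   ⟨11, 61441, 0x2100000000200402000800008420000800004020018000000000040a00010000020000211002100000000002000800000000200040000000⟩],
  [⟨11, 61441, 0x200000000022201004008000000000000a000000004080200000100800000000008b000a000000400000000000840001200020000000000000040008000400000000000000000000000000000000000000000000000000000000000000000000000000000000000000000000000000000000000000000⟩],
  [⟨11, 61441, 0x80000000000000000000000000000000000000000000000000000000000000000000000000000000000000000000000000000000000000000000000000000000000000000000000000000000000000000000000000000000000000000000000000000000000000000000000000000000000000000000000000000000000000⟩,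
   ⟨11, 65537, 0x8001000000200000800000000000010000000000000000010010000000000000000040000020000000000000000500010800000000000000000000000000210000008000000000100000000000000000000000000000000000000041001000000000000000000080800200000000020000400000200000000000000000000000⟩,
   ⟨11, 79873, 0x200000000⟩],
  [⟨11, 79873, 0x40000000000000002000010120000000000000000000000000000000000000000000000000000000020000000000000000000000000000000000000000000200000000000800000000000000000000002000020080000000001000000000000100000800800002000000000020000000000000000⟩,
   ⟨11, 83969, 0x1000000020002000000000000000000000000008000000000000000040000100000000000000000⟩],
  [⟨11, 83969, 0x10000000000000000000000000000000000000000000000020800000000000000000000000200000200000000000000000000200000000000000000010000000030000000000000000000000001000000000000000000000000000000000000000000000000000000000000000000000000000000000000000000⟩,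
   ⟨11, 86017, 0x4000000000000000000000000000082000000000000008000002000001000000000000000000000000000000000000000000000000000000000000000000000000000000000000000000000000000000000000000000000108000000000000000010000000000000000000000000001000000⟩,
   ⟨11, 114689, 0x800000000020000000000000000000000000000000000000000000000000000000000⟩],
  [⟨11, 120833, 0x1000000000000000000000000008000000000000000000000000000000000000000000000000000000000000000000200000000000000000000000000001000000000000000000000000⟩,
   ⟨11, 133121, 0x8000000000000000000000000000000000000000000000000000000000000000000000000000000000000000000000000000000000000000000000000000000000000000000000000000000000000000000000000000000000000000000000000000000000000⟩,
   ⟨11, 176129, 0x10000000000000000000000000000000000000000000000000000000000000000000⟩]]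

set_option maxRecDepth 100000 in
set_option maxHeartbeats 0 in
theorem check_certificates : ∀ l ∈ certificates, l.all Certificate.check = true := by
  simp only [certificates, List.forall_mem_cons]
  -- one kernel computation for each batch
  repeat' apply And.intro
  all_goals decide +kernel

set_option maxRecDepth 100000 in
theorem certificates_cover : ∀ r < 12, ∀ i < 2 ^ (r - 1), 2 ≤ r → 1 ≤ i →
    certificates.flatten.any (fun c => Nat.beq c.r r && c.mask.testBit i) = true := by
  decide +kernel

theorem mem_avoidedPrimes_of_mem {c : Certificate} (hc : c ∈ certificates.flatten) (hr : 1 ≤ c.r)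
    {i : ℕ} (hi : i < 2 ^ (c.r - 1)) (hi0 : 0 < i) (hm : c.mask.testBit i = true) :
    c.p ∈ avoidedPrimes (2 ^ (c.r - 1) + i) := by
  obtain ⟨l, hl, hc⟩ := List.mem_flatten.1 hc
  exact Certificate.check_spec hr (List.all_eq_true.1 (check_certificates l hl) c hc) hi hi0 hm

theorem exists_mem_avoidedPrimes {k : ℕ} (hk1 : 1 < k) (hk : k < 2048) (hpow : ¬ ∃ l, k = 2 ^ l) :
    ∃ p, p ∈ avoidedPrimes k := by
  set s := Nat.log 2 k with hs
  have h1 : 2 ^ s ≤ k := Nat.pow_log_le_self 2 (by omega)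
  have h2 : k < 2 ^ (s + 1) := Nat.lt_pow_succ_log_self one_lt_two k
  have h3 : k ≠ 2 ^ s := fun h => hpow ⟨s, h⟩
  have hs1 : 1 ≤ s := by
    rcases Nat.eq_zero_or_pos s with h | h
    · rw [h] at h2; omega
    · exact h
  have hs2 : s < 11 := (Nat.pow_lt_pow_iff_right one_lt_two).1 (h1.trans_lt (by simpa using hk))
  have hpow2 : 2 ^ (s + 1) = 2 * 2 ^ s := by rw [pow_succ']
  have h := certificates_cover (s + 1) (by omega) (k - 2 ^ s)
    (by rw [Nat.add_sub_cancel]; omega) (by omega) (by omega)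
  obtain ⟨c, hc, h⟩ := List.any_eq_true.1 h
  rw [Bool.and_eq_true, Nat.beq_eq] at h
  have hcs : c.r - 1 = s := by rw [h.1, Nat.add_sub_cancel]
  have hmem := mem_avoidedPrimes_of_mem hc (by omega) (by rw [hcs]; omega) (by omega) h.2
  rw [hcs, Nat.add_sub_cancel' h1] at hmem
  exact ⟨c.p, hmem⟩

/-- Pairs `(p, n)` such that the exponential sum of `σ_{n + 1, 1292}` is divisible by `p`. -/
def vanishingIndices : List (ℕ × ℕ) :=
  [(12289, 2988), (18433, 4193), (40961, 7329), (59393, 30024), (61441, 18284), (65537, 27381),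
   (79873, 28024), (83969, 60516), (86017, 31314), (114689, 66290), (120833, 18062), (133121,
   18783), (147457, 29222), (151553, 118930), (163841, 157833)]

set_option maxRecDepth 100000 in
set_option maxHeartbeats 0 in
theorem check_vanishingIndices :
    vanishingIndices.all (fun x => zeroCheck 11 1292 x.1 x.2) = true := by
  decide +kernel

/-- Every `2048 * m + 1` below `176129` has a small proper divisor or occurs in
`vanishingIndices`. -/
theorem composite_or_mem_vanishingIndices : ∀ m < 86, 1 ≤ m →
    ((List.range 400).any (fun d => Nat.ble 2 d && (Nat.ble (d + 1) (2048 * m + 1) &&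
      Nat.beq ((2048 * m + 1) % d) 0)) ||
      vanishingIndices.any fun x => Nat.beq x.1 (2048 * m + 1)) = true := by
  decide +kernel

theorem le_of_mem_avoidedPrimes {p : ℕ} (hp : p ∈ avoidedPrimes 1292) : 176129 ≤ p := by
  obtain ⟨hp, ⟨r, m, h1, h2, hm, rfl⟩, hav⟩ := hp
  have hr : r = 11 := by
    have h3 : 10 < r := by
      by_contra! h
      have : 2 ^ r ≤ 2 ^ 10 := Nat.pow_le_pow_right two_pos h
      omega
    have h4 : r - 1 < 11 := by
      by_contra! h
      have : 2 ^ 11 ≤ 2 ^ (r - 1) := Nat.pow_le_pow_right two_pos h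
      omega
    omega
  subst hr
  by_contra! hlt
  have h := composite_or_mem_vanishingIndices m (by omega) hm
  rw [Bool.or_eq_true, List.any_eq_true, List.any_eq_true] at h
  rcases h with ⟨d, _, hd⟩ | ⟨⟨q, n⟩, hx, hq⟩
  · simp only [Bool.and_eq_true, Nat.ble_eq, Nat.beq_eq] at hd
    obtain ⟨hd2, hdp, hd0⟩ := hd
    rcases (Nat.dvd_prime hp).1 (Nat.dvd_of_mod_eq_zero hd0) with h | h <;> omega
  · have hz := List.all_eq_true.1 check_vanishingIndices _ hx
    have h0 := zeroCheck_spec (by norm_num) (by norm_num) hz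
    rw [Nat.beq_eq] at hq
    simp only at hq h0
    subst hq
    exact hav (n + 1) (dvd_expSum_of_halfSum_eq_zero h0)

theorem mem_avoidedPrimes_1292 : 176129 ∈ avoidedPrimes 1292 := by
  have h : certificates.flatten.any (fun c => Nat.beq c.r 11 && (Nat.beq c.p 176129 &&
      c.mask.testBit 268)) = true := by decide +kernel
  obtain ⟨⟨r, p, mask⟩, hc, h⟩ := List.any_eq_true.1 h
  simp only [Bool.and_eq_true, Nat.beq_eq] at h
  obtain ⟨rfl, rfl, h⟩ := h
  exact mem_avoidedPrimes_of_mem hc (by norm_num) (by norm_num) (by norm_num) h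

end BoolSym

theorem mainTheorem7 :
    (∀ k : ℕ, 1 < k → k < 2048 → (¬ ∃ l : ℕ, k = 2 ^ l) →
      (∃ p : ℕ, p ∈ BoolSym.avoidedPrimes k) ∧
        ∀ n : ℕ, ¬ BoolSym.IsBalanced (BoolSym.sigma n k)) ∧
    IsLeast (BoolSym.avoidedPrimes 1292) 176129 := by
  refine ⟨fun k hk1 hk hpow => ?_, BoolSym.mem_avoidedPrimes_1292,
    fun p hp => BoolSym.le_of_mem_avoidedPrimes hp⟩
  obtain ⟨p, hp⟩ := BoolSym.exists_mem_avoidedPrimes hk1 hk hpow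
  refine ⟨⟨p, hp⟩, fun n hn => hp.2.2 n ?_⟩
  change BoolSym.expSum (BoolSym.sigma n k) = 0 at hn
  simp only [hn, dvd_zero]
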